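/- Let $n\ge 5$ be an integer, $B$ an $n$-element set and $p$ a prime. Let $\mathrm{Perm}(B)$ be the group of permutations of $B$ and $\mathrm{Alt}(B)$ its alternating subgroup. The group $\mathrm{Perm}(B)$ acts on the space $\mathbb F_p^B$ of maps $h:B\to\mathbb F_p$ by $(sh)(b)=h(s^{-1}b)$, preserving the hyperplane $(\mathbb F_p^B)^0=\{h\mid \sum_{b\in B}h(b)=0\}$ and the line $\mathbb F_p\cdot 1_B$ of constant functions. Let $V=(\mathbb F_p^B)^{00}$ be the heart of this representation: $V=(\mathbb F_p^B)^0/(\mathbb F_p\cdot 1_B)$ if $p\mid n$, and $V=(\mathbb F_p^B)^0$ if $p\nmid n$; let $\rho:\mathrm{Perm}(B)\to\mathrm{Aut}_{\mathbb F_p}(V)$ be the induced representation. For a subgroup $G\subset\mathrm{Perm}(B)$, an $\mathbb F_p$-subalgebra $R\subset\mathrm{End}_{\mathbb F_p}(V)$ containing $\mathrm{Id}$ is called $G$-normal if $\rho(\sigma)R\rho(\sigma)^{-1}\subset R$ for all $\sigma\in G$. The $G$-module $V$ is called very simple if every $G$-normal subalgebra equals $\mathbb F_p\cdot\mathrm{Id}$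 or $\mathrm{End}_{\mathbb F_p}(V)$, and central simple if every $G$-normal subalgebra is a central simple $\mathbb F_p$-algebra. Then: (i) The $\mathrm{Perm}(B)$-module $V$ is very simple. (ii) The $\mathrm{Alt}(B)$-module $V$ is very simple if and only if either $n>5$, or $n=5$ and $p\not\equiv\pm1\bmod 5$. (iii) If $n=5$, $p\equiv\pm1\bmod 5$ and $R\subset\mathrm{End}_{\mathbb F_p}(V)$ is an $\mathrm{Alt}(B)$-normal subalgebra, then either $R=\mathbb F_p\cdot\mathrm{Id}$, or $R=\mathrm{End}_{\mathbb F_p}(V)$, or the $\mathbb F_p$-algebra $R$ is isomorphic to the matrix algebra $\mathrm{Mat}_2(\mathbb F_p)$. (iv) The $\mathrm{Alt}(B)$-module $V$ is central simple. -/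

import Mathlib

namespace HeartModule

section NormalSubalgebras

variable {F G V : Type*} [Field F] [Group G] [AddCommGroup V] [Module F V]

/-- A subalgebra `R` of `End_F(V)` is `G`-normal if `ρ(σ) R ρ(σ)⁻¹ ⊆ R` for all `σ ∈ G`. -/
def IsNormalSubalgebra (ρ : Representation F G V) (R : Subalgebra F (Module.End F V)) : Prop :=
  ∀ σ : G, ∀ u ∈ R, ρ σ * u * ρ σ⁻¹ ∈ R

/-- A subalgebra of `End_F(V)` is obvious if it is `F · Id` (that is, `⊥`) or the whole `End_F(V)`. -/
def IsObvious (R : Subalgebra F (Module.End F V)) : Prop :=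
  R = ⊥ ∨ R = ⊤

/-- The `G`-module `V` is very simple if every `G`-normal subalgebra of `End_F(V)` is obvious. -/
def IsVerySimple (ρ : Representation F G V) : Prop :=
  ∀ R : Subalgebra F (Module.End F V), IsNormalSubalgebra ρ R → IsObvious R

/-- The `G`-module `V` is central simple if every `G`-normal subalgebra of `End_F(V)` is a central
simple `F`-algebra. -/
def IsCentralSimpleModule (ρ : Representation F G V) : Prop :=
  ∀ R : Subalgebra F (Module.End F V), IsNormalSubalgebra ρ R →
    Algebra.IsCentral F R ∧ IsSimpleRing R

end NormalSubalgebras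

section Heart

variable (F B : Type*) [Field F]

/-- The permutation representation of `Perm(B)` on the space of functions `B → F`:
`(s h)(b) = h(s⁻¹ b)`. -/
def permRep : Representation F (Equiv.Perm B) (B → F) where
  toFun s := LinearMap.funLeft F F (s⁻¹ : Equiv.Perm B)
  map_one' := rfl
  map_mul' s t := by
    ext h b
    simp [LinearMap.funLeft_apply]

/-- The line `F · 1_B` of constant functions. -/
def constLine : Submodule F (B → F) := Submodule.span F {fun _ => 1}

theorem mem_constLine_iff (h : B → F) : h ∈ constLine F B ↔ ∃ c : F, ∀ b, h b = c := by
  simp only [constLine, Submodule.mem_span_singleton, funext_iff, Pi.smul_apply, smul_eq_mul,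
    mul_one, eq_comm]

variable [Fintype B]

/-- The hyperplane `(F^B)^0` of functions with zero sum. -/
def sumZero : Submodule F (B → F) where
  carrier := {h | ∑ b, h b = 0}
  add_mem' {f g} hf hg := by
    simp only [Set.mem_ofPred_eq] at hf hg ⊢
    simp [Finset.sum_add_distrib, hf, hg]
  zero_mem' := by simp
  smul_mem' c f hf := by
    simp only [Set.mem_ofPred_eq] at hf ⊢
    simp [← Finset.mul_sum, hf]

theorem sumZero_invariant (s : Equiv.Perm B) :
    sumZero F B ≤ (sumZero F B).comap (permRep F B s) := by
  intro h hh
  change ∑ b, h ((s⁻¹ : Equiv.Perm B) b) = 0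
  rw [Equiv.sum_comp (s⁻¹ : Equiv.Perm B) h]
  exact hh

/-- The representation of `Perm(B)` on `(F^B)^0`. -/
def sumZeroRep : Representation F (Equiv.Perm B) (sumZero F B) :=
  (permRep F B).subrepresentation (sumZero F B) (sumZero_invariant F B)

/-- The intersection of `F · 1_B` with `(F^B)^0`, as a subspace of `(F^B)^0`. It is `F · 1_B` if
`char F` divides `|B|` and `0` otherwise: see `map_constInSumZero` and `constInSumZero_eq_bot`. -/
def constInSumZero : Submodule F (sumZero F B) :=
  (constLine F B).comap (sumZero F B).subtype

/-- If `|B| = 0` in `F`, then `F · 1_B` is contained in `(F^B)^0`, and `constInSumZero` is that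
line. -/
theorem map_constInSumZero (hB : (Fintype.card B : F) = 0) :
    (constInSumZero F B).map (sumZero F B).subtype = constLine F B := by
  rw [constInSumZero, Submodule.map_comap_subtype, inf_eq_right]
  intro h hh
  obtain ⟨c, hc⟩ := (mem_constLine_iff F B h).1 hh
  change ∑ b, h b = 0
  simp [hc, hB]

/-- If `|B| ≠ 0` in `F`, then `constInSumZero` is zero. -/
theorem constInSumZero_eq_bot (hB : (Fintype.card B : F) ≠ 0) : constInSumZero F B = ⊥ := by
  rw [eq_bot_iff]
  rintro ⟨h, h0⟩ hh
  obtain ⟨c, hc⟩ := (mem_constLine_iff F B h).1 hh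
  change ∑ b, h b = 0 at h0
  have hc0 : c = 0 := by simpa [hc, hB] using h0
  rw [Submodule.mem_bot]
  ext b
  simp [hc, hc0]

theorem constInSumZero_invariant (s : Equiv.Perm B) :
    constInSumZero F B ≤ (constInSumZero F B).comap (sumZeroRep F B s) := by
  intro h hh
  obtain ⟨c, hc⟩ := (mem_constLine_iff F B h).1 hh
  exact (mem_constLine_iff F B _).2 ⟨c, fun b => hc ((s⁻¹ : Equiv.Perm B) b)⟩

/-- The heart `(F^B)^{00}` of the permutation module: the quotient of `(F^B)^0` by its intersection
with `F · 1_B`, i.e. `(F^B)^0 / (F · 1_B)` if `char F` divides `|B|`, and `(F^B)^0` (modulo `0`)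
otherwise. -/
abbrev Heart : Type _ := sumZero F B ⧸ constInSumZero F B

/-- The representation of `Perm(B)` on the heart. -/
def heartRep : Representation F (Equiv.Perm B) (Heart F B) :=
  (sumZeroRep F B).quotient (constInSumZero F B) (constInSumZero_invariant F B)

/-- The restriction of `heartRep` to `Alt(B)`. -/
def heartRepAlt [DecidableEq B] : Representation F (alternatingGroup B) (Heart F B) :=
  (heartRep F B).comp (alternatingGroup B).subtype

end Heart

end HeartModule

/-! Clifford theory controls an `Alt(B)`-normal subalgebra `R ⊆ End(V)`. Since `V` is irreducible,
it is semisimple over `R`, and `Alt(B)` permutes its isotypic components. There are fewer than `|B|`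
of them, so the permutation action is trivial and irreducibility leaves a single component: `R` is
simple. The centre of `R` is a finite field on which the perfect group `Alt(B)` acts through an
abelian Galois group, hence trivially, so the centre commutes with `Alt(B)` and consists of scalars.

A 3-cycle `s` satisfies `rank (ρ(s) - 1) ≤ 2`. If `R` is neither `F` nor `End(V)`, choose `s` moving
a simple `R`-submodule `W`. As `W` meets its translate `sW` trivially, `ρ(s) - 1` is injective on
`W`, so `dim W = 2` and `ρ(s) - 1` has range in `W ⊕ sW`. Were this sum proper, `s` would act
trivially on the quotient, on which the simple ring `R` is faithful, and so would centralise `R`;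
hence `dim V = 4` and `R ≃ Mat₂(F)`.

For `Perm(B)` a transposition, with `rank (ρ(s) - 1) ≤ 1`, excludes this. For `Alt(B)` the
conjugation action embeds the group into `PGL₂(F)`, so `5 ∣ q (q² - 1)` where `q = |F|`. As
`dim V = 4`, either `|B| = 5` and `q ≡ ±1 mod 5`, or `|B| = 6` in characteristic `2` or `3`; the
latter contradicts the divisibility as `2² ≡ 3² ≡ -1 mod 5`, unless `q` is a square. Conversely, if
`|B| = 5` and `5` is a square, then `V` is four-dimensional orthogonal with square discriminant, and
`so₄` splits into two commuting ideals, one of which generates a proper normal subalgebra. -/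

namespace HeartModule

theorem isIrreducible_of_comp {F G H V : Type*} [Field F] [Monoid G] [Monoid H] [AddCommGroup V]
    [Module F V] {ρ : Representation F G V} (f : H →* G)
    (hρ : Representation.IsIrreducible (ρ.comp f)) : ρ.IsIrreducible := by
  let res (U : Subrepresentation ρ) : Subrepresentation (ρ.comp f) :=
    ⟨U.toSubmodule, fun h _ hv => U.apply_mem_toSubmodule (f h) hv⟩
  have hne : (⊥ : Subrepresentation ρ) ≠ ⊤ := fun h =>
    bot_ne_top (α := Subrepresentation (ρ.comp f)) (congrArg res h)
  have hinj : Function.Injective res := fun _ _ h =>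
    Subrepresentation.toSubmodule_injective (Subrepresentation.mk.inj h)
  exact
    { exists_pair_ne := ⟨⊥, ⊤, hne⟩
      eq_bot_or_eq_top U := (eq_bot_or_eq_top (res U)).imp (@hinj U ⊥) (@hinj U ⊤) }

section NormalSubalgebra

variable {F G V : Type*} [Field F] [Group G] [AddCommGroup V] [Module F V]
variable {ρ : Representation F G V} {R : Subalgebra F (Module.End F V)}

/-- The action of `G` on a `G`-normal subalgebra `R ⊆ End_F(V)` by conjugation. -/
def conjAut (hR : IsNormalSubalgebra ρ R) : G →* (R ≃ₐ[F] R) where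
  toFun g :=
    { toFun r := ⟨ρ g * r * ρ g⁻¹, hR g r r.2⟩
      invFun r := ⟨ρ g⁻¹ * r * ρ g, by simpa using hR g⁻¹ r r.2⟩
      left_inv r := by ext v; simp
      right_inv r := by ext v; simp
      map_mul' r s := by ext v; simp
      map_add' r s := by ext v; simp
      commutes' c := by ext v; simp [Module.algebraMap_end_apply] }
  map_one' := by ext r v; simp
  map_mul' g h := by ext r v; simp

variable (hR : IsNormalSubalgebra ρ R)

theorem coe_conjAut_apply (g : G) (r : R) :
    (conjAut hR g r : Module.End F V) = ρ g * r * ρ g⁻¹ := rfl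

theorem rho_smul (g : G) (r : R) (v : V) : ρ g (r • v) = conjAut hR g r • ρ g v := by
  simp [Subalgebra.smul_def, coe_conjAut_apply]

theorem mem_bot_of_conjAut_apply_eq (hρ : Subalgebra.centralizer F (Set.range ρ) = ⊥) {r : R}
    (hr : ∀ g, conjAut hR g r = r) : r ∈ (⊥ : Subalgebra F R) := by
  have hcentral : (r : Module.End F V) ∈ Subalgebra.centralizer F (Set.range ρ) := by
    rw [Subalgebra.mem_centralizer_iff, Set.forall_mem_range]
    intro g
    nth_rw 2 [← hr g]
    ext v
    simp [coe_conjAut_apply]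
  rw [hρ] at hcentral
  obtain ⟨c, hc⟩ := Algebra.mem_bot.1 hcentral
  exact Algebra.mem_bot.2 ⟨c, Subtype.ext hc⟩

theorem conjAut_injective [IsSimpleGroup G] (hρ : Subalgebra.centralizer F (Set.range ρ) = ⊥)
    (hbot : R ≠ ⊥) : Function.Injective (conjAut hR) := by
  rw [← MonoidHom.ker_eq_bot_iff]
  refine (IsSimpleGroup.eq_bot_or_eq_top_of_normal _ inferInstance).resolve_right
    fun hker => hbot ?_
  rw [eq_bot_iff]
  intro r hr
  have hfix (g : G) : conjAut hR g ⟨r, hr⟩ = ⟨r, hr⟩ :=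
    DFunLike.congr_fun (MonoidHom.mem_ker.1 (hker ▸ Subgroup.mem_top g)) _
  obtain ⟨c, hc⟩ := Algebra.mem_bot.1 (mem_bot_of_conjAut_apply_eq hR hρ hfix)
  exact Algebra.mem_bot.2 ⟨c, congrArg Subtype.val hc⟩

/-- The operator `ρ g`, which is semilinear over `R` along the conjugation automorphism of `g`. -/
def semilinearRho (g : G) : V →ₛₗ[(conjAut hR g : R →+* R)] V where
  __ := (ρ g).toAddMonoidHom
  map_smul' r v := rho_smul hR g r v

/-- The action of `G` on the lattice of `R`-submodules of `V`, sending `W` to `ρ g (W)`. It is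
encoded as the preimage under `ρ g⁻¹`. -/
def translate : G →* (Submodule R V ≃o Submodule R V) where
  toFun g :=
    { toFun W := W.comap (semilinearRho hR g⁻¹)
      invFun W := W.comap (semilinearRho hR g)
      left_inv W := by ext v; simp [semilinearRho]
      right_inv W := by ext v; simp [semilinearRho]
      map_rel_iff' {W W'} := by
        refine ⟨fun h v hv => ?_, fun h v hv => h hv⟩
        simpa [semilinearRho] using @h (ρ g v) (by simpa [semilinearRho] using hv) }
  map_one' := by ext W v; simp [semilinearRho]
  map_mul' g h := by ext W v; simp [semilinearRho]

variable {hR} {g : G} {W W' : Submodule R V} {v : V}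

theorem mem_translate : v ∈ translate hR g W ↔ ρ g⁻¹ v ∈ W := Iff.rfl

theorem rho_mem_translate (hv : v ∈ W) : ρ g v ∈ translate hR g W := by
  simpa [mem_translate] using hv

theorem eq_bot_or_top_of_translate_eq [ρ.IsIrreducible] (hW : ∀ g, translate hR g W = W) :
    W = ⊥ ∨ W = ⊤ := by
  let U : Subrepresentation ρ :=
    ⟨W.restrictScalars F, fun g _ hv => hW g ▸ rho_mem_translate hv⟩
  refine (eq_bot_or_eq_top U).imp (fun h => ?_) (fun h => ?_)
  · exact (Submodule.restrictScalars_eq_bot_iff F R V).1 (congrArg (·.toSubmodule) h)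
  · exact (Submodule.restrictScalars_eq_top_iff F R V).1 (congrArg (·.toSubmodule) h)

theorem eq_bot_or_top_of_forall_mem_translate_eq [ρ.IsIrreducible] {S : Set G}
    (hS : Subgroup.closure S = ⊤) (hW : ∀ g ∈ S, translate hR g W = W) : W = ⊥ ∨ W = ⊤ := by
  let stab : Subgroup G := (MulAction.stabilizer (Submodule R V ≃o Submodule R V) W).comap
    (translate hR)
  have hstab : stab = ⊤ := top_unique (hS ▸ (Subgroup.closure_le stab).2 hW)
  exact eq_bot_or_top_of_translate_eq fun g => hstab.ge (Subgroup.mem_top g)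

variable (hR g W) in
/-- The operator `ρ g` as an `F`-linear isomorphism between a submodule and its translate. -/
def translateEquiv : W ≃ₗ[F] translate hR g W where
  toFun w := ⟨ρ g w, rho_mem_translate w.2⟩
  invFun w := ⟨ρ g⁻¹ w, w.2⟩
  left_inv w := by ext; simp
  right_inv w := by ext; simp
  map_add' v w := by ext; simp
  map_smul' c w := by ext; simp

variable (hR g W) in
theorem translateEquiv_smul (r : R) (w : W) :
    translateEquiv hR g W (r • w) = conjAut hR g r • translateEquiv hR g W w :=
  Subtype.ext (rho_smul hR g r w)

end NormalSubalgebra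

section Clifford

theorem isSimpleRing_of_isIsotypic {A M : Type*} [Ring A] [IsArtinianRing A] [Nontrivial A]
    [AddCommGroup M] [Module A M] [FaithfulSMul A M] [IsSemisimpleModule A M]
    (hM : IsIsotypic A M) : IsSimpleRing A := by
  have hjac : Ring.jacobson A = ⊥ := by
    rw [← le_bot_iff, ← Module.annihilator_eq_bot.2 ‹FaithfulSMul A M›]
    exact IsSemisimpleModule.jacobson_le_annihilator A M
  have hss : IsSemisimpleRing A := IsArtinianRing.isSemisimpleRing_iff_jacobson.2 hjac
  have hembed (I : Submodule A A) (hI : IsSimpleModule A I) :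
      ∃ N : Submodule A M, Nonempty (I ≃ₗ[A] N) := by
    have := hI.nontrivial
    obtain ⟨x, hx⟩ := exists_ne (0 : I)
    obtain ⟨v, hv⟩ : ∃ v : M, (x : A) • v ≠ 0 := by
      by_contra! h
      exact hx (Subtype.ext (FaithfulSMul.eq_of_smul_eq_smul (α := M) (by simpa using h)))
    let f : I →ₗ[A] M := (LinearMap.toSpanSingleton A M v).comp I.subtype
    have hf : f ≠ 0 := fun h => hv (by simpa [f] using LinearMap.congr_fun h x)
    exact ⟨_, ⟨LinearEquiv.ofInjective f (LinearMap.injective_of_ne_zero hf)⟩⟩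
  refine (isSimpleRing_isArtinianRing_iff.2 ⟨hss, fun I hI J hJ => ?_, inferInstance⟩).1
  obtain ⟨N, ⟨eI⟩⟩ := hembed I hI
  obtain ⟨P, ⟨eJ⟩⟩ := hembed J hJ
  have := IsSimpleModule.congr eI.symm
  have := IsSimpleModule.congr eJ.symm
  obtain ⟨e⟩ := hM N P
  exact ⟨eJ.trans (e.trans eI.symm)⟩

theorem card_isotypicComponents_le_finrank {F A M : Type*} [Field F] [Ring A] [Algebra F A]
    [AddCommGroup M] [Module F M] [Module A M] [IsScalarTower F A M] [Module.Finite F M]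
    [IsSemisimpleModule A M] :
    Nat.card (isotypicComponents A M) ≤ Module.finrank F M := by
  let res := Submodule.restrictScalarsLatticeHom F A M
  have := isNoetherian_of_tower (R := F) (S := A) (M := M) inferInstance
  have := Fintype.ofFinite (isotypicComponents A M)
  have hindep : iSupIndep fun c : isotypicComponents A M => res c := fun c => by
    have h := ((sSupIndep_iff _).1 (sSupIndep_isotypicComponents A M) c).map res
    simpa only [map_iSup] using h
  have hne (c : isotypicComponents A M) : res c ≠ ⊥ := fun h =>
    (bot_lt_isotypicComponents c.2).ne' ((Submodule.restrictScalars_eq_bot_iff F A M).1 h)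
  classical
  calc
    Nat.card (isotypicComponents A M) = Fintype.card {c : isotypicComponents A M // res c ≠ ⊥} := by
      rw [Nat.card_eq_fintype_card, Fintype.card_congr (Equiv.subtypeUnivEquiv hne)]
    _ ≤ Module.finrank F M := hindep.subtype_ne_bot_le_finrank

theorem nonempty_linearEquiv_of_semilinear {A M M' N N' : Type*} [Semiring A]
    [AddCommMonoid M] [AddCommMonoid M'] [AddCommMonoid N] [AddCommMonoid N'] [Module A M]
    [Module A M'] [Module A N] [Module A N'] {σ : A → A} (hσ : Function.Surjective σ)
    (τ : M ≃+ N) (hτ : ∀ a m, τ (a • m) = σ a • τ m)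
    (τ' : M' ≃+ N') (hτ' : ∀ a m, τ' (a • m) = σ a • τ' m) (e : M ≃ₗ[A] M') :
    Nonempty (N ≃ₗ[A] N') := by
  refine ⟨(τ.symm.trans (e.toAddEquiv.trans τ')).toLinearEquiv fun a n => ?_⟩
  obtain ⟨m, rfl⟩ := τ.surjective n
  obtain ⟨a, rfl⟩ := hσ a
  simp [← hτ, hτ']

variable {F G V : Type*} [Field F] [Group G] [AddCommGroup V] [Module F V]
variable {ρ : Representation F G V} {R : Subalgebra F (Module.End F V)}

theorem nontrivial_of_isIrreducible (ρ : Representation F G V) [ρ.IsIrreducible] :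
    Nontrivial V := by
  by_contra h
  have := not_nontrivial_iff_subsingleton.1 h
  exact bot_ne_top (α := Subrepresentation ρ)
    (Subrepresentation.toSubmodule_injective (Subsingleton.elim _ _))

variable (hR : IsNormalSubalgebra ρ R)

variable {hR} in
theorem isSimpleModule_translate (g : G) {W : Submodule R V} (hW : IsSimpleModule R W) :
    IsSimpleModule R (translate hR g W) := by
  rw [isSimpleModule_iff_isAtom] at hW ⊢
  exact ((translate hR g).isAtom_iff W).2 hW

theorem nonempty_translate_linearEquiv (g : G) {W W' : Submodule R V} (e : W ≃ₗ[R] W') :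
    Nonempty (translate hR g W ≃ₗ[R] translate hR g W') :=
  nonempty_linearEquiv_of_semilinear (conjAut hR g).surjective (translateEquiv hR g W).toAddEquiv
    (translateEquiv_smul hR g W) (translateEquiv hR g W').toAddEquiv
    (translateEquiv_smul hR g W') e

theorem translate_isotypicComponent (g : G) (S : Submodule R V) :
    translate hR g (isotypicComponent R V S) = isotypicComponent R V (translate hR g S) := by
  have hinv (W : Submodule R V) : translate hR g⁻¹ (translate hR g W) = W := by
    rw [← RelIso.mul_apply, ← map_mul, inv_mul_cancel, map_one, RelIso.one_apply]
  rw [isotypicComponent, OrderIso.map_sSup_eq_sSup_symm_preimage, isotypicComponent]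
  congr 1
  ext W
  obtain ⟨W, rfl⟩ := (translate hR g).surjective W
  rw [Set.mem_preimage, OrderIso.symm_apply_apply]
  refine ⟨fun ⟨e⟩ => nonempty_translate_linearEquiv hR g e, fun ⟨e⟩ => ?_⟩
  have he := nonempty_translate_linearEquiv hR g⁻¹ e
  rwa [hinv, hinv] at he

/-- The permutation action of `G` on the isotypic components of `V` as an `R`-module. -/
def isotypicPerm : G →* Equiv.Perm (isotypicComponents R V) :=
  have hmem (g : G) {c : Submodule R V} (hc : c ∈ isotypicComponents R V) :
      translate hR g c ∈ isotypicComponents R V := by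
    obtain ⟨S, hS, rfl⟩ := hc
    exact ⟨_, isSimpleModule_translate g hS, translate_isotypicComponent hR g S⟩
  { toFun g := (translate hR g).toEquiv.subtypeEquiv fun c => ⟨hmem g, fun hc => by
      simpa [← RelIso.mul_apply, ← map_mul] using hmem g⁻¹ hc⟩
    map_one' := by ext c; simp
    map_mul' g h := by ext c; simp }

include hR in
theorem isSemisimpleModule_of_isNormalSubalgebra [ρ.IsIrreducible] [Module.Finite F V] :
    IsSemisimpleModule R V := by
  have := isArtinian_of_tower (R := F) (S := R) (M := V) inferInstance
  have := nontrivial_of_isIrreducible ρ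
  obtain ⟨W, hW⟩ := IsAtomic.exists_atom (Submodule R V)
  have htop : ⨆ g, translate hR g W = ⊤ := by
    refine (eq_bot_or_top_of_translate_eq (hR := hR) fun g => ?_).resolve_left fun hbot => hW.1 ?_
    · rw [OrderIso.map_iSup]
      simp only [← RelIso.mul_apply, ← map_mul]
      exact (Equiv.mulLeft g).iSup_comp (g := fun h => translate hR h W)
    · simpa using (iSup_eq_bot.1 hbot) 1
  refine isSemisimpleModule_of_isSemisimpleModule_submodule' (fun g => ?_) htop
  have := isSimpleModule_translate (hR := hR) g (isSimpleModule_iff_isAtom.2 hW)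
  infer_instance

theorem isIsotypic_of_isotypicPerm_eq_one [ρ.IsIrreducible] [Module.Finite F V]
    (hperm : isotypicPerm hR = 1) : IsIsotypic R V := by
  have := isSemisimpleModule_of_isNormalSubalgebra hR
  intro W hW
  have htop : isotypicComponent R V W = ⊤ :=
    (eq_bot_or_top_of_translate_eq (hR := hR) fun g => congrArg Subtype.val
      (Equiv.congr_fun (DFunLike.congr_fun hperm g) ⟨_, W, hW, rfl⟩)).resolve_left
      (bot_lt_isotypicComponent W).ne'
  exact isotypicComponent_eq_top_iff.1 htop

theorem isSimpleRing_of_isotypicPerm_eq_one [ρ.IsIrreducible] [Module.Finite F V]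
    (hperm : isotypicPerm hR = 1) : IsSimpleRing R := by
  have := isSemisimpleModule_of_isNormalSubalgebra hR
  have := nontrivial_of_isIrreducible ρ
  have : IsArtinianRing R := isArtinian_of_tower F inferInstance
  exact isSimpleRing_of_isIsotypic (isIsotypic_of_isotypicPerm_eq_one hR hperm)

end Clifford

section Center

variable {F A : Type*} [Field F] [Ring A] [Algebra F A]

/-- The restriction of the automorphisms of an algebra to its center. -/
def centerAut : (A ≃ₐ[F] A) →* (Subalgebra.center F A ≃ₐ[F] Subalgebra.center F A) where
  toFun e :=
    { Subring.centerCongr e.toRingEquiv with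
      commutes' := fun c => Subtype.ext (e.commutes c) }
  map_one' := rfl
  map_mul' _ _ := rfl

theorem monoidHom_eq_one_of_isPerfect {G H : Type*} [Group G] [Group.IsPerfect G] [Group H]
    [IsMulCommutative H] (f : G →* H) : f = 1 := by
  rw [← MonoidHom.ker_eq_top_iff, ← top_le_iff, ← Group.IsPerfect.commutator_eq_top (G := G),
    commutator_def, Subgroup.commutator_le]
  intro g _ h _
  rw [MonoidHom.mem_ker, map_commutatorElement, commutatorElement_eq_one_iff_mul_comm]
  exact mul_comm' _ _

theorem isCentral_of_isNormalSubalgebra {G V : Type*} [Finite F] [Group G] [Group.IsPerfect G]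
    [AddCommGroup V] [Module F V] [Module.Finite F V] {ρ : Representation F G V}
    (hρ : Subalgebra.centralizer F (Set.range ρ) = ⊥) {R : Subalgebra F (Module.End F V)}
    (hR : IsNormalSubalgebra ρ R) [IsSimpleRing R] : Algebra.IsCentral F R := by
  have := Module.finite_of_finite F (M := R)
  have hfield : IsField (Subalgebra.center F R) := IsSimpleRing.isField_center R
  let : Field (Subalgebra.center F R) := hfield.toField
  have : IsMulCommutative (Subalgebra.center F R ≃ₐ[F] Subalgebra.center F R) :=
    IsCyclic.isMulCommutative
  have hfix : centerAut.comp (conjAut hR) = 1 := monoidHom_eq_one_of_isPerfect _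
  refine ⟨fun z hz => mem_bot_of_conjAut_apply_eq hR hρ fun g => ?_⟩
  exact congrArg Subtype.val (DFunLike.congr_fun (DFunLike.congr_fun hfix g) ⟨z, hz⟩)

end Center

section SimpleModule

variable {F A W : Type*} [Field F] [Ring A] [Algebra F A] [IsSimpleRing A]
  [AddCommGroup W] [Module F W] [Module A W] [IsScalarTower F A W]

theorem lsmul_injective [Nontrivial W] :
    Function.Injective (Algebra.lsmul F F W : A →ₐ[F] Module.End F W) :=
  RingHom.injective (Algebra.lsmul F F W : A →ₐ[F] Module.End F W).toRingHom

variable [Algebra.IsCentral F A] [Finite W] [IsSimpleModule A W]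

theorem exists_smul_eq_moduleEnd (d : Module.End A W) : ∃ c : F, ∀ w, d w = c • w := by
  have := IsSimpleModule.nontrivial A W
  have : Finite (Module.End A W) := Finite.of_injective _ DFunLike.coe_injective
  have : IsDomain (Module.End A W) := by classical infer_instance
  have hcomm := (Finite.isDomain_to_isField (Module.End A W)).mul_comm
  let d' : Module.End (Module.End A W) W :=
    { toAddHom := d.toAddHom, map_smul' := fun e w => LinearMap.congr_fun (hcomm d e) w }
  obtain ⟨r, hr⟩ := Module.Finite.toModuleEnd_moduleEnd_surjective (R := A) (M := W) d'
  have hr (w : W) : r • w = d w := LinearMap.congr_fun hr w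
  have hcenter : r ∈ Subalgebra.center F A :=
    Subalgebra.mem_center_iff.2 fun a => lsmul_injective (F := F) (W := W) <| by
      ext w
      simp [hr]
  obtain ⟨c, rfl⟩ := Algebra.mem_bot.1 (Algebra.IsCentral.out hcenter)
  exact ⟨c, fun w => by rw [← hr, algebraMap_smul]⟩

theorem lsmul_bijective :
    Function.Bijective (Algebra.lsmul F F W : A →ₐ[F] Module.End F W) := by
  have := IsSimpleModule.nontrivial A W
  refine ⟨lsmul_injective, fun f => ?_⟩
  let f' : Module.End (Module.End A W) W :=
    { toAddHom := f.toAddHom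
      map_smul' := fun d w => by
        obtain ⟨c, hc⟩ := exists_smul_eq_moduleEnd (F := F) d
        simp [hc] }
  obtain ⟨r, hr⟩ := Module.Finite.toModuleEnd_moduleEnd_surjective (R := A) (M := W) f'
  exact ⟨r, LinearMap.ext fun w => LinearMap.congr_fun hr w⟩

variable (F A W) in
/-- A finite central simple algebra acts on its simple module as the full endomorphism algebra. -/
noncomputable def algEquivEnd : A ≃ₐ[F] Module.End F W :=
  AlgEquiv.ofBijective (Algebra.lsmul F F W) lsmul_bijective

variable (F A W) in
theorem finrank_eq_sq : Module.finrank F A = Module.finrank F W ^ 2 := by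
  have : Module.Finite F W := inferInstance
  rw [(algEquivEnd F A W).toLinearEquiv.finrank_eq, Module.finrank_linearMap, sq]

end SimpleModule

section EndAutomorphisms

open LinearMap (GeneralLinearGroup)

variable {F W : Type*} [Field F] [Finite F] [AddCommGroup W] [Module F W] [Module.Finite F W]

theorem natCard_sub_one_mul_natCard_algAut_end_dvd [Nontrivial W] :
    (Nat.card F - 1) * Nat.card (Module.End F W ≃ₐ[F] Module.End F W) ∣
      Nat.card (GeneralLinearGroup F W) := by
  have := Module.finite_of_finite F (M := Module.End F W)
  let conj : ConjAct (GeneralLinearGroup F W) →* Module.End F W ≃ₐ[F] Module.End F W :=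
    MulSemiringAction.toAlgAut _ F _
  have hconj : conj.range = ⊤ :=
    MonoidHom.range_eq_top.2 Module.End.mulSemiringActionToAlgEquiv_conjAct_surjective
  let scalar : Fˣ →* GeneralLinearGroup F W := Units.map (algebraMap F (Module.End F W))
  have hscalar : Function.Injective scalar :=
    Units.map_injective (algebraMap F (Module.End F W)).injective
  let scalarConj : Fˣ →* conj.ker := (ConjAct.toConjAct.toMonoidHom.comp scalar).codRestrict _
    fun c => by
      ext f w
      simp [conj, scalar, ConjAct.units_smul_def]
  have hker : Nat.card F - 1 ∣ Nat.card conj.ker := by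
    rw [← Nat.card_units]
    refine Subgroup.card_dvd_of_injective scalarConj fun c d h => hscalar ?_
    exact congrArg (fun x => ConjAct.ofConjAct x.1) h
  have hcard := conj.ker.card_mul_index
  rw [Subgroup.index_ker, hconj, Subgroup.card_top] at hcard
  exact (mul_dvd_mul_right hker _).trans hcard.dvd

theorem natCard_algAut_end_dvd_of_finrank_eq_two (hW : Module.finrank F W = 2) :
    Nat.card (Module.End F W ≃ₐ[F] Module.End F W) ∣ Nat.card F * (Nat.card F ^ 2 - 1) := by
  have := Fintype.ofFinite F
  have := Module.nontrivial_of_finrank_pos (R := F) (M := W) (by lia)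
  have hcard : Nat.card (GeneralLinearGroup F W) =
      (Nat.card F - 1) * (Nat.card F * (Nat.card F ^ 2 - 1)) := by
    have e : GeneralLinearGroup F W ≃* GL (Fin 2) F :=
      Units.mapEquiv (algEquivMatrix (Module.finBasisOfFinrankEq F W hW)).toMulEquiv
    rw [Nat.card_congr e.toEquiv, Matrix.card_GL_field, Nat.card_eq_fintype_card]
    have hsq : Fintype.card F ^ 2 - Fintype.card F = Fintype.card F * (Fintype.card F - 1) := by
      rw [Nat.mul_sub_one, sq]
    simp only [Fin.prod_univ_two, Fin.val_zero, Fin.val_one, pow_zero, pow_one, hsq]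
    ring
  have hpos : 0 < Nat.card F - 1 := Nat.sub_pos_of_lt Finite.one_lt_card
  exact Nat.dvd_of_mul_dvd_mul_left hpos (hcard ▸ natCard_sub_one_mul_natCard_algAut_end_dvd)

section

variable {A : Type*} [Ring A] [Algebra F A] [Algebra.IsCentral F A] [IsSimpleRing A] [Module A W]
  [IsScalarTower F A W] [IsSimpleModule A W]

theorem nonempty_algEquiv_matrix_of_finrank_eq_two (hW : Module.finrank F W = 2) :
    Nonempty (A ≃ₐ[F] Matrix (Fin 2) (Fin 2) F) :=
  have := Module.finite_of_finite F (M := W)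
  ⟨(algEquivEnd F A W).trans (algEquivMatrix (Module.finBasisOfFinrankEq F W hW))⟩

theorem natCard_algAut_dvd_of_finrank_eq_two (hW : Module.finrank F W = 2) :
    Nat.card (A ≃ₐ[F] A) ∣ Nat.card F * (Nat.card F ^ 2 - 1) := by
  have := Module.finite_of_finite F (M := W)
  rw [Nat.card_congr (AlgEquiv.autCongr (algEquivEnd F A W)).toEquiv]
  exact natCard_algAut_end_dvd_of_finrank_eq_two hW

end

end EndAutomorphisms

section RankArguments

variable {F G V : Type*} [Field F] [Group G] [AddCommGroup V] [Module F V]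
variable {ρ : Representation F G V} {R : Subalgebra F (Module.End F V)}
variable {hR : IsNormalSubalgebra ρ R} {W : Submodule R V} {s : G}

theorem disjoint_translate [hW : IsSimpleModule R W] (hs : translate hR s W ≠ W) :
    Disjoint W (translate hR s W) := by
  have hsW := isSimpleModule_translate (hR := hR) s hW
  rw [isSimpleModule_iff_isAtom] at hW hsW
  exact hW.disjoint_of_ne hsW hs.symm

theorem finrank_map_rho_sub_one [IsSimpleModule R W] (hs : translate hR s W ≠ W) :
    Module.finrank F ((W.restrictScalars F).map (ρ s - 1)) = Module.finrank F W := by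
  rw [← LinearMap.range_domRestrict]
  refine LinearMap.finrank_range_of_inj <| (injective_iff_map_eq_zero _).2 fun w hw => ?_
  have hfix : ρ s w = w := sub_eq_zero.1 (by simpa using hw)
  have hmem : (w : V) ∈ translate hR s W := hfix ▸ rho_mem_translate w.2
  exact Subtype.ext (Submodule.disjoint_def.1 (disjoint_translate hs) w w.2 hmem)

theorem map_rho_sub_one_le : (W.restrictScalars F).map (ρ s - 1) ≤
    (W ⊔ translate hR s W).restrictScalars F := by
  rintro _ ⟨w, hw, rfl⟩
  exact Submodule.sub_mem _ (Submodule.mem_sup_right (rho_mem_translate hw))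
    (Submodule.mem_sup_left hw)

theorem conjAut_eq_one_of_range_le [IsSimpleRing R] {U : Submodule R V} (hU : U ≠ ⊤)
    (hs : LinearMap.range (ρ s - 1) ≤ U.restrictScalars F) : conjAut hR s = 1 := by
  have := Submodule.Quotient.nontrivial_iff.2 hU
  ext1 r
  refine lsmul_injective (F := F) (W := V ⧸ U) (LinearMap.ext (U.mkQ_surjective.forall.2 ?_))
  intro v
  have hmkQ (v : V) : U.mkQ (ρ s v) = U.mkQ v :=
    (Submodule.Quotient.eq U).2 (hs ⟨v, rfl⟩)
  change conjAut hR s r • U.mkQ v = r • U.mkQ v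
  rw [← hmkQ v, ← map_smul, ← rho_smul, hmkQ, map_smul, hmkQ]

variable [Module.Finite F V]

theorem finrank_le_finrank_range [IsSimpleModule R W] (hs : translate hR s W ≠ W) :
    Module.finrank F W ≤ Module.finrank F (LinearMap.range (ρ s - 1)) :=
  (finrank_map_rho_sub_one hs).ge.trans (Submodule.finrank_mono LinearMap.map_le_range)

theorem finrank_eq_two_mul_finrank [IsSimpleRing R] [IsSimpleModule R W]
    (hs : translate hR s W ≠ W) (hconj : conjAut hR s ≠ 1)
    (hrank : Module.finrank F (LinearMap.range (ρ s - 1)) ≤ Module.finrank F W) :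
    Module.finrank F V = 2 * Module.finrank F W := by
  have hrange : (W.restrictScalars F).map (ρ s - 1) = LinearMap.range (ρ s - 1) :=
    Submodule.eq_of_le_of_finrank_le LinearMap.map_le_range
      (hrank.trans (finrank_map_rho_sub_one hs).ge)
  have htop : W ⊔ translate hR s W = ⊤ := by
    by_contra hU
    exact hconj (conjAut_eq_one_of_range_le hU (hrange ▸ map_rho_sub_one_le))
  have hcompl : IsCompl (W.restrictScalars F) ((translate hR s W).restrictScalars F) :=
    (IsCompl.of_eq (disjoint_translate hs).eq_bot htop).map
      (Submodule.restrictScalarsLatticeHom F R V)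
  rw [← Submodule.finrank_add_eq_of_isCompl hcompl, two_mul]
  exact congrArg _ (translateEquiv hR s W).finrank_eq.symm

end RankArguments

section Classification

variable {F G V : Type*} [Field F] [Finite F] [Group G] [AddCommGroup V] [Module F V]
variable [Module.Finite F V] {ρ : Representation F G V} {R : Subalgebra F (Module.End F V)}

section SimpleSubmodule

variable [IsSimpleRing R] [Algebra.IsCentral F R] {W : Submodule R V} [IsSimpleModule R W]

theorem finrank_subalgebra_eq_sq : Module.finrank F R = Module.finrank F W ^ 2 :=
  have := Module.finite_of_finite F (M := V)
  finrank_eq_sq F R W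

theorem eq_top_of_isSimpleModule_top (hW : W = ⊤) : R = ⊤ := by
  have hWV : Module.finrank F W = Module.finrank F V := by
    change Module.finrank F (W.restrictScalars F) = _
    rw [hW, Submodule.restrictScalars_top, finrank_top]
  rw [← Algebra.toSubmodule_eq_top]
  refine Submodule.eq_top_of_finrank_eq ?_
  rw [Module.finrank_linearMap, ← sq, ← hWV]
  exact finrank_subalgebra_eq_sq

theorem two_le_finrank (hbot : R ≠ ⊥) : 2 ≤ Module.finrank F W := by
  have := IsSimpleModule.nontrivial R W
  have := Module.finite_of_finite F (M := V)
  have hpos : 0 < Module.finrank F W :=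
    Module.finrank_pos (R := F) (M := W)
  have hne : Module.finrank F W ≠ 1 := fun h =>
    hbot (Subalgebra.eq_bot_of_finrank_one (by rw [finrank_subalgebra_eq_sq (W := W), h, one_pow]))
  lia

theorem exists_translate_ne [ρ.IsIrreducible] (hR : IsNormalSubalgebra ρ R) (htop : R ≠ ⊤)
    {S : Set G} (hS : Subgroup.closure S = ⊤) : ∃ s ∈ S, translate hR s W ≠ W := by
  by_contra! h
  rcases eq_bot_or_top_of_forall_mem_translate_eq hS h with hW | hW
  · exact (isSimpleModule_iff_isAtom.1 ‹_›).1 hW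
  · exact htop (eq_top_of_isSimpleModule_top hW)

end SimpleSubmodule

/-- The natural module `V` of `R` has a simple submodule of dimension two. -/
def HasSimplePlane (R : Subalgebra F (Module.End F V)) : Prop :=
  ∃ W : Submodule R V, IsSimpleModule R W ∧ Module.finrank F W = 2

namespace HasSimplePlane

theorem nonempty_algEquiv_matrix [IsSimpleRing R] [Algebra.IsCentral F R]
    (hplane : HasSimplePlane R) : Nonempty (R ≃ₐ[F] Matrix (Fin 2) (Fin 2) F) := by
  obtain ⟨W, _, hW⟩ := hplane
  have := Module.finite_of_finite F (M := V)
  exact nonempty_algEquiv_matrix_of_finrank_eq_two (W := W) hW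

theorem natCard_dvd [IsSimpleGroup G] (hρ : Subalgebra.centralizer F (Set.range ρ) = ⊥)
    (hR : IsNormalSubalgebra ρ R) [IsSimpleRing R] [Algebra.IsCentral F R] (hbot : R ≠ ⊥)
    (hplane : HasSimplePlane R) : Nat.card G ∣ Nat.card F * (Nat.card F ^ 2 - 1) := by
  obtain ⟨W, _, hW⟩ := hplane
  have := Module.finite_of_finite F (M := V)
  have := Module.finite_of_finite F (M := R)
  exact (Subgroup.card_dvd_of_injective (conjAut hR) (conjAut_injective hR hρ hbot)).trans
    (natCard_algAut_dvd_of_finrank_eq_two (W := W) hW)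

end HasSimplePlane

omit [Finite F] in
theorem not_hasSimplePlane [ρ.IsIrreducible] (hR : IsNormalSubalgebra ρ R) {S : Set G}
    (hS : Subgroup.closure S = ⊤)
    (hrank : ∀ s ∈ S, Module.finrank F (LinearMap.range (ρ s - 1)) ≤ 1)
    (hV : Module.finrank F V ≠ 2) : ¬ HasSimplePlane R := by
  rintro ⟨W, hW, hW2⟩
  have hstable (s : G) (hs : s ∈ S) : translate hR s W = W := by
    by_contra hne
    have hle := (finrank_le_finrank_range hne).trans (hrank s hs)
    lia
  rcases eq_bot_or_top_of_forall_mem_translate_eq hS hstable with rfl | rfl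
  · exact (isSimpleModule_iff_isAtom.1 hW).1 rfl
  · refine hV (Eq.trans ?_ hW2)
    exact finrank_top F V |>.symm

theorem finrank_eq_four_and_hasSimplePlane [IsSimpleGroup G] [ρ.IsIrreducible]
    (hρ : Subalgebra.centralizer F (Set.range ρ) = ⊥) (hR : IsNormalSubalgebra ρ R)
    [IsSimpleRing R] [Algebra.IsCentral F R] {S : Set G} (hS : Subgroup.closure S = ⊤)
    (hrank : ∀ s ∈ S, Module.finrank F (LinearMap.range (ρ s - 1)) ≤ 2)
    (hbot : R ≠ ⊥) (htop : R ≠ ⊤) : Module.finrank F V = 4 ∧ HasSimplePlane R := by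
  have := nontrivial_of_isIrreducible ρ
  have := isArtinian_of_tower (R := F) (S := R) (M := V) inferInstance
  obtain ⟨W, hatom⟩ := IsAtomic.exists_atom (Submodule R V)
  have hW := isSimpleModule_iff_isAtom.2 hatom
  obtain ⟨s, hsS, hs⟩ := exists_translate_ne (W := W) hR htop hS
  have hW2 : Module.finrank F W = 2 :=
    ((finrank_le_finrank_range hs).trans (hrank s hsS)).antisymm (two_le_finrank hbot)
  have hconj : conjAut hR s ≠ 1 := fun h => by
    obtain rfl : s = 1 := conjAut_injective hR hρ hbot (h.trans (map_one _).symm)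
    exact hs (by rw [map_one, RelIso.one_apply])
  refine ⟨?_, W, hW, hW2⟩
  rw [finrank_eq_two_mul_finrank hs hconj ((hrank s hsS).trans hW2.ge), hW2]

end Classification

section AlternatingGroup

variable {B : Type*} [Fintype B]

theorem exists_nodup_of_ne (hB : 5 ≤ Fintype.card B) {a b : B} (hab : a ≠ b) :
    ∃ c d e, [a, b, c, d, e].Nodup := by
  classical
  have hcard : 2 < ({a, b}ᶜ : Finset B).card := by
    rw [Finset.card_compl, Finset.card_pair hab]; lia
  obtain ⟨c, hc, d, hd, e, he, hcde⟩ := Finset.two_lt_card.1 hcard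
  simp only [Finset.mem_compl, Finset.mem_insert, Finset.mem_singleton] at hc hd he
  exact ⟨c, d, e, by grind⟩

variable [DecidableEq B]

theorem exists_alternatingGroup_support_eq {a b c : B} (habc : [a, b, c].Nodup) :
    ∃ s : alternatingGroup B,
      (s : Equiv.Perm B) a = b ∧ (s : Equiv.Perm B).support = {a, b, c} := by
  have hne : (a ≠ b ∧ a ≠ c) ∧ b ≠ c := by simpa using habc
  obtain ⟨⟨hab, hac⟩, hbc⟩ := hne
  refine ⟨⟨Equiv.swap a b * Equiv.swap b c, ?_⟩, ?_, Equiv.Perm.support_swap_mul_swap habc⟩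
  · simp [Equiv.Perm.mem_alternatingGroup, Equiv.Perm.sign_swap hab, Equiv.Perm.sign_swap hbc]
  · simp [Equiv.swap_apply_of_ne_of_ne hab hac]

theorem exists_alternatingGroup_apply_eq (hB : 4 ≤ Fintype.card B) {a b i j : B} (hab : a ≠ b)
    (hij : i ≠ j) :
    ∃ g : alternatingGroup B, (g : Equiv.Perm B) a = i ∧ (g : Equiv.Perm B) b = j := by
  have := alternatingGroup.isMultiplyPretransitive B
  have : MulAction.IsMultiplyPretransitive (alternatingGroup B) B 2 :=
    MulAction.isMultiplyPretransitive_of_le (n := Nat.card B - 2)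
      (by rw [Nat.card_eq_fintype_card]; lia) (by simp)
  exact MulAction.is_two_pretransitive_iff.1 this hab hij

end AlternatingGroup

section Dimension

variable {F B : Type*} [Field F] [Fintype B]

variable (F B) in
theorem finrank_sumZero_add_one [Nonempty B] :
    Module.finrank F (sumZero F B) + 1 = Fintype.card B := by
  have hker : sumZero F B = (Fintype.linearCombination F (fun _ : B => (1 : F))).ker := by
    ext h
    rw [LinearMap.mem_ker, Fintype.linearCombination_apply]
    simp only [smul_eq_mul, mul_one]
    rfl
  rw [hker, Module.Dual.finrank_ker_add_one_of_ne_zero, Module.finrank_fintype_fun_eq_card]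
  obtain ⟨t⟩ := ‹Nonempty B›
  classical
  exact fun h => one_ne_zero (α := F) (by simpa using LinearMap.congr_fun h (Pi.single t 1))

theorem finrank_constInSumZero [Nonempty B] (hB : (Fintype.card B : F) = 0) :
    Module.finrank F (constInSumZero F B) = 1 := by
  rw [← Submodule.finrank_map_subtype_eq, map_constInSumZero F B hB, constLine]
  exact finrank_span_singleton fun h => one_ne_zero (congrFun h (Classical.arbitrary B))

theorem finrank_heart_add_one [Nonempty B] (hB : (Fintype.card B : F) ≠ 0) :
    Module.finrank F (Heart F B) + 1 = Fintype.card B := by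
  have hquot := (constInSumZero F B).finrank_quotient_add_finrank
  have hbot : Module.finrank F (constInSumZero F B) = 0 := by
    rw [constInSumZero_eq_bot F B hB, finrank_bot]
  rw [← finrank_sumZero_add_one F B, ← hquot, hbot]

theorem finrank_heart_add_two [Nonempty B] (hB : (Fintype.card B : F) = 0) :
    Module.finrank F (Heart F B) + 2 = Fintype.card B := by
  rw [← finrank_sumZero_add_one F B, ← (constInSumZero F B).finrank_quotient_add_finrank,
    finrank_constInSumZero hB]

variable (F)

theorem finrank_heart_lt_card [Nonempty B] : Module.finrank F (Heart F B) < Fintype.card B := by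
  by_cases hB : (Fintype.card B : F) = 0
  · have := finrank_heart_add_two hB; lia
  · have := finrank_heart_add_one hB; lia

theorem card_le_finrank_heart_add_two [Nonempty B] :
    Fintype.card B ≤ Module.finrank F (Heart F B) + 2 := by
  by_cases hB : (Fintype.card B : F) = 0
  · exact (finrank_heart_add_two hB).ge
  · have := finrank_heart_add_one hB; lia

theorem nontrivial_heart (hB : 3 ≤ Fintype.card B) : Nontrivial (Heart F B) := by
  have : Nonempty B := Fintype.card_pos_iff.1 (by lia)
  have := card_le_finrank_heart_add_two F (B := B)
  exact Module.nontrivial_of_finrank_pos (R := F) (by lia)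

end Dimension

section Heart

variable (F : Type*) {B : Type*} [Field F] [Fintype B]

/-- The projection `(F^B)^0 → (F^B)^{00}` of the functions with zero sum onto the heart. -/
def heartMk : sumZero F B →ₗ[F] Heart F B := (constInSumZero F B).mkQ

theorem heartMk_surjective : Function.Surjective (heartMk F (B := B)) :=
  Submodule.mkQ_surjective _

variable {F} in
theorem heartMk_eq_heartMk_iff {h k : sumZero F B} :
    heartMk F h = heartMk F k ↔ ∃ c : F, ∀ b, (h : B → F) b - (k : B → F) b = c := by
  rw [heartMk, Submodule.mkQ_apply, Submodule.mkQ_apply, Submodule.Quotient.eq]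
  exact mem_constLine_iff F B _

variable {F} in
theorem sumZeroRep_apply (s : Equiv.Perm B) (h : sumZero F B) (b : B) :
    (sumZeroRep F B s h : B → F) b = (h : B → F) (s⁻¹ b) := rfl

variable {F} in
theorem heartRep_heartMk (s : Equiv.Perm B) (h : sumZero F B) :
    heartRep F B s (heartMk F h) = heartMk F (sumZeroRep F B s h) := rfl

/-- The functions with zero sum that vanish outside `T`. -/
def supportedIn (T : Finset B) : Submodule F (sumZero F B) where
  carrier := {h | ∀ b ∉ T, (h : B → F) b = 0}
  add_mem' hf hg b hb := by simp [hf b hb, hg b hb]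
  zero_mem' b _ := rfl
  smul_mem' c f hf b hb := by simp [hf b hb]

theorem map_supportedIn_inf_le [DecidableEq B] {S T : Finset B} (hST : S ∪ T ≠ Finset.univ) :
    (supportedIn F S).map (heartMk F) ⊓ (supportedIn F T).map (heartMk F) ≤
      (supportedIn F (S ∩ T)).map (heartMk F) := by
  rintro _ ⟨⟨h, hh, rfl⟩, k, hk, hkh⟩
  obtain ⟨c, hc⟩ := heartMk_eq_heartMk_iff.1 hkh
  obtain ⟨e, he⟩ : ∃ e, e ∉ S ∪ T := by simpa [Finset.eq_univ_iff_forall] using hST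
  rw [Finset.notMem_union] at he
  have hc0 : c = 0 := by rw [← hc e, hh e he.1, hk e he.2, sub_zero]
  refine ⟨h, fun b hb => ?_, rfl⟩
  by_cases hbS : b ∈ S
  · have hbT : b ∉ T := fun hbT => hb (Finset.mem_inter.2 ⟨hbS, hbT⟩)
    rw [← sub_eq_zero.1 ((hc b).trans hc0), hk b hbT]
  · exact hh b hbS

variable [DecidableEq B]

/-- The difference of the indicator functions of `a` and `b`. -/
def edgeFun (a b : B) : sumZero F B :=
  ⟨Pi.single a 1 - Pi.single b 1, by
    change ∑ x, (Pi.single a (1 : F) - Pi.single b (1 : F) : B → F) x = 0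
    simp⟩

theorem edgeFun_apply (a b x : B) :
    (edgeFun F a b : B → F) x = (if x = a then 1 else 0) - (if x = b then 1 else 0) := by
  simp [edgeFun, Pi.single_apply]

theorem sumZeroRep_edgeFun (s : Equiv.Perm B) (a b : B) :
    sumZeroRep F B s (edgeFun F a b) = edgeFun F (s a) (s b) := by
  ext x
  simp only [sumZeroRep_apply, edgeFun_apply, Equiv.Perm.inv_eq_iff_eq]

theorem heartRep_edgeFun (s : Equiv.Perm B) (a b : B) :
    heartRep F B s (heartMk F (edgeFun F a b)) = heartMk F (edgeFun F (s a) (s b)) := by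
  rw [heartRep_heartMk, sumZeroRep_edgeFun]

theorem edgeFun_self (a : B) : edgeFun F a a = 0 := by
  ext x
  rw [edgeFun_apply, sub_self]; rfl

theorem supportedIn_le_span_edgeFun (T : Finset B) (t : B) :
    supportedIn F T ≤ Submodule.span F ((edgeFun F · t) '' (T.erase t : Finset B)) := by
  intro h hh
  have hsum : ∑ b ∈ T, (h : B → F) b = 0 :=
    (Finset.sum_subset T.subset_univ fun b _ hb => hh b hb).trans h.2
  have hdecomp : h = ∑ b ∈ T, (h : B → F) b • edgeFun F b t := by
    ext x
    have hx : (if x ∈ T then (h : B → F) x else 0) = (h : B → F) x :=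
      ite_eq_left_iff.2 fun hxT => (hh x hxT).symm
    simp [edgeFun_apply, mul_sub, Finset.sum_sub_distrib, hsum, hx]
  rw [hdecomp, ← Finset.sum_erase T (a := t) (by rw [edgeFun_self, smul_zero])]
  exact Submodule.sum_mem _ fun b hb => Submodule.smul_mem _ _ (Submodule.subset_span ⟨b, hb, rfl⟩)

omit [DecidableEq B] in
theorem finrank_supportedIn_le {T : Finset B} (hT : T.Nonempty) :
    Module.finrank F (supportedIn F T) ≤ T.card - 1 := by
  classical
  obtain ⟨t, ht⟩ := hT
  refine (Submodule.finrank_mono (supportedIn_le_span_edgeFun F T t)).trans ?_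
  rw [← Finset.coe_image, ← Finset.card_erase_of_mem ht]
  exact (finrank_span_finset_le_card _).trans Finset.card_image_le

theorem supportedIn_pair_le_span_edgeFun (a b : B) :
    supportedIn F {a, b} ≤ Submodule.span F {edgeFun F a b} := by
  refine (supportedIn_le_span_edgeFun F {a, b} b).trans (Submodule.span_le.2 ?_)
  rintro _ ⟨x, hx, rfl⟩
  obtain rfl : x = a := by grind
  exact Submodule.mem_span_singleton_self _

theorem eq_top_of_forall_edgeFun_mem {U : Submodule F (Heart F B)}
    (hU : ∀ a b, a ≠ b → heartMk F (edgeFun F a b) ∈ U) : U = ⊤ := by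
  refine eq_top_iff.2 fun x _ => ?_
  obtain ⟨h, rfl⟩ := heartMk_surjective F x
  cases isEmpty_or_nonempty B
  · rw [Subsingleton.elim h 0, map_zero]; exact U.zero_mem
  · obtain ⟨t⟩ := ‹Nonempty B›
    have hle : Submodule.span F ((edgeFun F · t) '' (Finset.univ.erase t : Finset B)) ≤
        U.comap (heartMk F) := by
      refine Submodule.span_le.2 ?_
      rintro _ ⟨b, hb, rfl⟩
      exact hU b t (Finset.ne_of_mem_erase hb)
    exact hle (supportedIn_le_span_edgeFun F _ t fun b hb => absurd (Finset.mem_univ b) hb)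

variable {F}

theorem sub_sumZeroRep_mem_supportedIn (s : Equiv.Perm B) (h : sumZero F B) :
    h - sumZeroRep F B s h ∈ supportedIn F s.support := fun b hb => by
  have hsb : s⁻¹ b = b := Equiv.Perm.inv_eq_iff_eq.2 (Equiv.Perm.notMem_support.1 hb).symm
  change (h : B → F) b - (h : B → F) (s⁻¹ b) = 0
  rw [hsb, sub_self]

theorem range_heartRep_sub_one_le (s : Equiv.Perm B) :
    LinearMap.range (heartRep F B s - 1) ≤ (supportedIn F s.support).map (heartMk F) := by
  rintro _ ⟨x, rfl⟩
  obtain ⟨h, rfl⟩ := heartMk_surjective F x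
  exact ⟨-(h - sumZeroRep F B s h), neg_mem (sub_sumZeroRep_mem_supportedIn s h),
    by simp [heartRep_heartMk]⟩

theorem finrank_range_heartRep_sub_one_le {s : Equiv.Perm B} (hs : s ≠ 1) :
    Module.finrank F (LinearMap.range (heartRep F B s - 1)) ≤ s.support.card - 1 :=
  ((Submodule.finrank_mono (range_heartRep_sub_one_le s)).trans
    (Submodule.finrank_map_le _ _)).trans
    (finrank_supportedIn_le F (Finset.nonempty_iff_ne_empty.2 (by simpa using hs)))

theorem sub_sumZeroRep_eq_smul_edgeFun {T : Finset B} {h : sumZero F B} (hh : h ∈ supportedIn F T)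
    {s : Equiv.Perm B} {b : B} (hTs : T ∩ s.support ⊆ {b}) :
    h - sumZeroRep F B s h = (h : B → F) b • edgeFun F b (s b) := by
  have hzero (x : B) (hx : s x ≠ x) (hxb : x ≠ b) : (h : B → F) x = 0 :=
    hh x fun hxT => hxb (Finset.mem_singleton.1
      (hTs (Finset.mem_inter.2 ⟨hxT, Equiv.Perm.mem_support.2 hx⟩)))
  ext x
  obtain ⟨y, rfl⟩ := s.surjective x
  simp only [AddSubgroupClass.coe_sub, Pi.sub_apply, SetLike.val_smul, Pi.smul_apply, smul_eq_mul,
    sumZeroRep_apply, Equiv.Perm.coe_inv, Equiv.symm_apply_apply, edgeFun_apply]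
  have hinj (x : B) : s y = s x ↔ y = x := s.injective.eq_iff
  grind

theorem eq_top_of_edgeFun_mem (hB : 4 ≤ Fintype.card B) {U : Submodule F (Heart F B)}
    (hU : ∀ (g : alternatingGroup B), ∀ x ∈ U, heartRep F B g x ∈ U) {a b : B} (hab : a ≠ b)
    (hmem : heartMk F (edgeFun F a b) ∈ U) : U = ⊤ := by
  refine eq_top_of_forall_edgeFun_mem F fun i j hij => ?_
  obtain ⟨g, rfl, rfl⟩ := exists_alternatingGroup_apply_eq hB hab hij
  rw [← heartRep_edgeFun]
  exact hU g _ hmem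

omit [DecidableEq B] in
theorem exists_apply_ne_of_heartMk_ne_zero {h : sumZero F B} (hh : heartMk F h ≠ 0) :
    ∃ a b, (h : B → F) a ≠ (h : B → F) b := by
  contrapose! hh
  rw [← map_zero (heartMk F), heartMk_eq_heartMk_iff]
  cases isEmpty_or_nonempty B
  · exact ⟨0, isEmptyElim⟩
  · obtain ⟨t⟩ := ‹Nonempty B›
    exact ⟨(h : B → F) t, fun b => (sub_zero _).trans (hh b t)⟩

theorem exists_edgeFun_mem (hB : 5 ≤ Fintype.card B) {U : Submodule F (Heart F B)}
    (hU : ∀ (g : alternatingGroup B), ∀ x ∈ U, heartRep F B g x ∈ U) (hbot : U ≠ ⊥) :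
    ∃ a b, a ≠ b ∧ heartMk F (edgeFun F a b) ∈ U := by
  -- One 3-cycle `s` cuts the support of `h` down to three points; a second one `t`, whose support
  -- meets these in the single point `b`, leaves a multiple of an edge.
  obtain ⟨x, hxU, hx⟩ := U.exists_mem_ne_zero_of_ne_bot hbot
  obtain ⟨h, rfl⟩ := heartMk_surjective F x
  obtain ⟨a, b, hab⟩ := exists_apply_ne_of_heartMk_ne_zero hx
  obtain ⟨c, d, e, hnodup⟩ := exists_nodup_of_ne hB (ne_of_apply_ne _ hab)
  obtain ⟨s, hsa, hs⟩ := exists_alternatingGroup_support_eq (a := a) (b := b) (c := c) (by grind)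
  obtain ⟨t, htb, ht⟩ := exists_alternatingGroup_support_eq (a := b) (b := d) (c := e) (by grind)
  have hsub (g : alternatingGroup B) (k : sumZero F B) (hk : heartMk F k ∈ U) :
      heartMk F (k - sumZeroRep F B g k) ∈ U :=
    map_sub (heartMk F) k _ ▸ U.sub_mem hk (hU g _ hk)
  have hk : h - sumZeroRep F B s h ∈ supportedIn F {a, b, c} :=
    hs ▸ sub_sumZeroRep_mem_supportedIn _ h
  have hkb : ((h - sumZeroRep F B s h : sumZero F B) : B → F) b ≠ 0 := by
    have hsb : (s : Equiv.Perm B)⁻¹ b = a := Equiv.Perm.inv_eq_iff_eq.2 hsa.symm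
    change (h : B → F) b - (h : B → F) ((s : Equiv.Perm B)⁻¹ b) ≠ 0
    rw [hsb, sub_ne_zero]
    exact hab.symm
  have hedge := hsub t _ (hsub s h hxU)
  rw [sub_sumZeroRep_eq_smul_edgeFun hk (b := b) (by rw [ht]; grind), map_smul, htb] at hedge
  exact ⟨b, d, by grind, (U.smul_mem_iff hkb).1 hedge⟩

theorem isIrreducible_heartRepAlt (hB : 5 ≤ Fintype.card B) :
    (heartRepAlt F B).IsIrreducible where
  exists_pair_ne := by
    have := nontrivial_heart F (B := B) (by lia)
    exact ⟨⊥, ⊤, fun h => bot_ne_top (congrArg Subrepresentation.toSubmodule h)⟩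
  eq_bot_or_eq_top U := by
    refine or_iff_not_imp_left.2 fun hbot => ?_
    have hU (g : alternatingGroup B) (x : Heart F B) (hx : x ∈ U.toSubmodule) :
        heartRep F B g x ∈ U.toSubmodule := U.apply_mem_toSubmodule g hx
    obtain ⟨a, b, hab, hmem⟩ := exists_edgeFun_mem hB hU fun h =>
      hbot (Subrepresentation.toSubmodule_injective h)
    exact Subrepresentation.toSubmodule_injective (eq_top_of_edgeFun_mem (by lia) hU hab hmem)

omit [DecidableEq B] in
theorem isIrreducible_heartRep (hB : 5 ≤ Fintype.card B) : (heartRep F B).IsIrreducible := by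
  classical
  exact isIrreducible_of_comp (alternatingGroup B).subtype (isIrreducible_heartRepAlt hB)

theorem apply_edgeFun_mem_span (hB : 5 ≤ Fintype.card B) {u : Module.End F (Heart F B)}
    (hu : ∀ g : alternatingGroup B, Commute (heartRep F B g) u) {a b : B} (hab : a ≠ b) :
    u (heartMk F (edgeFun F b a)) ∈ Submodule.span F {heartMk F (edgeFun F b a)} := by
  -- The edge lies in the range of `ρ s - 1` for every 3-cycle `s` on `{a, b, x}`, so its image
  -- under `u` is supported in `{a, b, x}`; two choices of `x` confine it to `{a, b}`.
  obtain ⟨c, d, e, hnodup⟩ := exists_nodup_of_ne hB hab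
  have hmem {x : B} (hx : [a, b, x, e].Nodup) :
      u (heartMk F (edgeFun F b a)) ∈ (supportedIn F {a, b, x}).map (heartMk F) := by
    obtain ⟨s, hsa, hs⟩ := exists_alternatingGroup_support_eq (a := a) (b := b) (c := x) (by grind)
    have hse : (s : Equiv.Perm B) e = e := Equiv.Perm.notMem_support.1 (by rw [hs]; grind)
    have hedge : (heartRep F B s - 1) (heartMk F (edgeFun F a e)) = heartMk F (edgeFun F b a) := by
      rw [LinearMap.sub_apply, heartRep_edgeFun, hsa, hse, Module.End.one_apply, ← map_sub]
      congr 1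
      ext y
      simp [edgeFun_apply]
    have hcomm : Commute (heartRep F B s - 1) u := (hu s).sub_left (Commute.one_left u)
    rw [← hs, ← hedge]
    exact range_heartRep_sub_one_le _ ⟨u _, LinearMap.congr_fun hcomm _⟩
  have hinter := map_supportedIn_inf_le F (S := {a, b, c}) (T := {a, b, d})
    (fun h => by have := Finset.eq_univ_iff_forall.1 h e; grind)
    ⟨hmem (x := c) (by grind), hmem (x := d) (by grind)⟩
  rw [show ({a, b, c} ∩ {a, b, d} : Finset B) = {b, a} by grind] at hinter
  have hspan := Submodule.map_mono (supportedIn_pair_le_span_edgeFun F b a) hinter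
  rwa [Submodule.map_span, Set.image_singleton] at hspan

theorem centralizer_range_heartRepAlt (hB : 5 ≤ Fintype.card B) :
    Subalgebra.centralizer F (Set.range (heartRepAlt F B)) = ⊥ := by
  refine eq_bot_iff.2 fun u hu => ?_
  have hcomm (g : alternatingGroup B) : Commute (heartRep F B g) u := hu _ ⟨g, rfl⟩
  obtain ⟨a, b, hab⟩ := Fintype.one_lt_card_iff.1 (by lia : 1 < Fintype.card B)
  obtain ⟨z, hz⟩ := Submodule.mem_span_singleton.1 (apply_edgeFun_mem_span hB hcomm hab)
  refine Algebra.mem_bot.2 ⟨z, LinearMap.ext fun x => ?_⟩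
  have htop : LinearMap.eqLocus (algebraMap F (Module.End F (Heart F B)) z) u = ⊤ := by
    refine eq_top_of_edgeFun_mem (by lia) (fun g x hx => ?_) hab.symm hz
    have hgx : u (heartRep F B g x) = heartRep F B g (u x) := LinearMap.congr_fun (hcomm g).symm x
    rw [LinearMap.mem_eqLocus] at hx ⊢
    rw [hgx, ← hx]
    exact ((heartRep F B g).map_smul z x).symm
  exact htop.ge Submodule.mem_top

end Heart

section NotVerySimple

variable {F G V : Type*} [Field F] [Group G] [AddCommGroup V] [Module F V]
  {ρ : Representation F G V}

theorem isNormalSubalgebra_centralizer_range_conj (y : Module.End F V) :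
    IsNormalSubalgebra ρ
      (Subalgebra.centralizer F (Set.range fun g => ρ g * y * ρ g⁻¹)) := by
  rintro s u hu _ ⟨g, rfl⟩
  have hs : ρ s * ρ s⁻¹ = 1 := by rw [← map_mul, mul_inv_cancel, map_one]
  have hs' (x : Module.End F V) : ρ s * (ρ s⁻¹ * x) = x := by rw [← mul_assoc, hs, one_mul]
  have hcomm := congrArg (ρ s * · * ρ s⁻¹) (hu _ ⟨s⁻¹ * g, rfl⟩)
  simpa only [mul_inv_rev, inv_inv, map_mul, mul_assoc, hs, hs', mul_one] using hcomm

theorem not_isVerySimple_of_forall_commute_conj {x y : Module.End F V}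
    (hx : x ∉ (⊥ : Subalgebra F (Module.End F V))) (hy : y ∉ (⊥ : Subalgebra F (Module.End F V)))
    (hxy : ∀ g, Commute (ρ g * y * ρ g⁻¹) x) : ¬ IsVerySimple ρ := by
  intro hρ
  rcases hρ _ (isNormalSubalgebra_centralizer_range_conj y) with h | h
  · refine hx (h ▸ ?_)
    rintro _ ⟨g, rfl⟩
    exact hxy g
  · refine hy (Algebra.IsCentral.out (Subalgebra.mem_center_iff.2 fun u => ?_))
    have hu : u ∈ Subalgebra.centralizer F (Set.range fun g => ρ g * y * ρ g⁻¹) :=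
      h ▸ Algebra.mem_top
    exact (hu y ⟨1, by simp⟩).symm

end NotVerySimple

section BalancedMatrices

open Matrix

variable {R B C : Type*} [CommRing R] [Fintype B] [Fintype C]

/-- The matrices all of whose column sums and row sums vanish: they map all functions to functions
with zero sum and kill the constants, and so act on the heart. -/
structure IsBalanced (M : Matrix B B R) : Prop where
  one_vecMul : 1 ᵥ* M = 0
  mulVec_one : M *ᵥ 1 = 0

theorem IsBalanced.submatrix {M : Matrix B B R} (hM : IsBalanced M) (e : C ≃ B) :
    IsBalanced (M.submatrix e e) where
  one_vecMul := by
    rw [submatrix_vecMul_equiv, Pi.one_comp, hM.one_vecMul, Pi.zero_comp]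
  mulVec_one := by
    rw [submatrix_mulVec_equiv, Pi.one_comp, hM.mulVec_one, Pi.zero_comp]

theorem isBalanced_circulant [AddCommGroup B] {v : B → R} (hv : ∑ b, v b = 0) :
    IsBalanced (circulant v) where
  one_vecMul := by
    ext b
    simpa [vecMul, one_dotProduct] using (Equiv.sum_comp (Equiv.subRight b) v).trans hv
  mulVec_one := by
    ext b
    simpa [mulVec, dotProduct_one] using (Equiv.sum_comp (Equiv.subLeft b) v).trans hv

variable {F : Type*} [Field F] {M N : Matrix B B F}

theorem IsBalanced.mulVec_mem_sumZero (hM : IsBalanced M) (h : B → F) :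
    M *ᵥ h ∈ sumZero F B := by
  change ∑ b, (M *ᵥ h) b = 0
  rw [← one_dotProduct, dotProduct_mulVec, hM.one_vecMul, zero_dotProduct]

/-- The endomorphism of the heart induced by a balanced matrix. -/
def matrixEnd (hM : IsBalanced M) : Module.End F (Heart F B) :=
  (constInSumZero F B).mapQ (constInSumZero F B)
    (M.mulVecLin.restrict fun h _ => hM.mulVec_mem_sumZero h) fun h hh => by
      obtain ⟨c, hc⟩ := (mem_constLine_iff F B h).1 hh
      refine (mem_constLine_iff F B _).2 ⟨0, fun b => ?_⟩
      have hh' : (h : B → F) = c • 1 := funext fun b => by simp [← hc b]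
      change (M *ᵥ (h : B → F)) b = 0
      rw [hh', mulVec_smul, hM.mulVec_one, smul_zero, Pi.zero_apply]

theorem matrixEnd_heartMk (hM : IsBalanced M) (h : sumZero F B) :
    matrixEnd hM (heartMk F h) = heartMk F ⟨M *ᵥ h, hM.mulVec_mem_sumZero h⟩ := rfl

theorem commute_matrixEnd (hM : IsBalanced M) (hN : IsBalanced N) (hMN : Commute M N) :
    Commute (matrixEnd hM) (matrixEnd hN) := by
  refine LinearMap.ext fun x => ?_
  obtain ⟨h, rfl⟩ := heartMk_surjective F x
  simp only [Module.End.mul_apply, matrixEnd_heartMk, mulVec_mulVec, hMN.eq]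

theorem heartRep_mul_matrixEnd_mul (hM : IsBalanced M) (s : Equiv.Perm B) :
    heartRep F B s * matrixEnd hM * heartRep F B s⁻¹ = matrixEnd (hM.submatrix s⁻¹) := by
  refine LinearMap.ext fun x => ?_
  obtain ⟨h, rfl⟩ := heartMk_surjective F x
  refine congrArg (heartMk F) (Subtype.ext ?_)
  exact (submatrix_mulVec_equiv M h _ s⁻¹).symm

variable [DecidableEq B]

theorem exists_forall_sub_eq_of_matrixEnd_mem_bot (hM : IsBalanced M)
    (h : matrixEnd hM ∈ (⊥ : Subalgebra F (Module.End F (Heart F B)))) (a b : B) :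
    ∃ z c : F, ∀ x, M x a - M x b - z * (edgeFun F a b : B → F) x = c := by
  obtain ⟨z, hz⟩ := Algebra.mem_bot.1 h
  have hab := LinearMap.congr_fun hz (heartMk F (edgeFun F a b))
  rw [Module.algebraMap_end_apply, ← map_smul, matrixEnd_heartMk] at hab
  obtain ⟨c, hc⟩ := heartMk_eq_heartMk_iff.1 hab.symm
  have hmul : M *ᵥ (edgeFun F a b : B → F) = fun x => M x a - M x b := by
    ext x
    simp [edgeFun, mulVec_sub]
  exact ⟨z, c, fun x => congrFun hmul x ▸ hc x⟩

end BalancedMatrices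

section FivePoints

open Matrix

/-- The skew-symmetric circulant matrix of size five with entries `α` and `β` in the residue classes
`1` and `2`. If `√5 ∈ F`, the Lie algebra `so₄` of the skew-symmetric balanced matrices is the sum
of two commuting ideals, stable under `Alt(5)` and exchanged by `√5 ↦ -√5`. The parameters
`(1, 2 + √5)` and `(2 + √5, -1)`, the latter proportional to `(1, 2 - √5)`, give an element of
each. -/
def skewCirculant {R : Type*} [CommRing R] (α β : R) : Matrix (Fin 5) (Fin 5) R :=
  circulant ![0, α, β, -β, -α]

theorem isBalanced_skewCirculant {R : Type*} [CommRing R] (α β : R) :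
    IsBalanced (skewCirculant α β) :=
  isBalanced_circulant (by simp [Fin.sum_univ_five])

theorem map_skewCirculant {R S : Type*} [CommRing R] [CommRing S] (f : R →+* S) (α β : R) :
    (skewCirculant α β).map f = skewCirculant (f α) (f β) := by
  rw [skewCirculant, map_circulant, skewCirculant]
  congr 1
  ext i
  fin_cases i <;> simp

theorem skewCirculant_mul_submatrix_zsqrtd (g : Equiv.Perm (Fin 5)) (hg : Equiv.Perm.sign g = 1) :
    skewCirculant (1 : ℤ√5) ⟨2, 1⟩ * (skewCirculant ⟨2, 1⟩ (-1)).submatrix g g =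
      (skewCirculant ⟨2, 1⟩ (-1)).submatrix g g * skewCirculant (1 : ℤ√5) ⟨2, 1⟩ := by
  revert g
  decide +kernel

theorem commute_skewCirculant_submatrix {R : Type*} [CommRing R] {s : R} (hs : s * s = 5)
    {g : Equiv.Perm (Fin 5)} (hg : Equiv.Perm.sign g = 1) :
    Commute (skewCirculant 1 (2 + s)) ((skewCirculant (2 + s) (-1)).submatrix g g) := by
  let f : ℤ√5 →+* R := Zsqrtd.lift ⟨s, by rw [hs, Int.cast_ofNat]⟩
  have hf : f ⟨2, 1⟩ = 2 + s := by simp [f, Zsqrtd.lift]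
  have h := congrArg f.mapMatrix (skewCirculant_mul_submatrix_zsqrtd g hg)
  simpa only [commute_iff_eq, map_mul, RingHom.mapMatrix_apply, ← submatrix_map,
    map_skewCirculant, hf, map_one, map_neg] using h

variable {F B : Type*} [Field F] [Fintype B]

theorem matrixEnd_skewCirculant_notMem_bot (e : B ≃ Fin 5) {α β : F} (h2 : (2 : F) ≠ 0)
    (h5 : (5 : F) ≠ 0) (hβ : β ≠ 0) :
    matrixEnd ((isBalanced_skewCirculant α β).submatrix e) ∉
      (⊥ : Subalgebra F (Module.End F (Heart F B))) := by
  classical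
  intro h
  obtain ⟨z, c, hc⟩ := exists_forall_sub_eq_of_matrixEnd_mem_bot _ h (e.symm 0) (e.symm 1)
  have hcol (i : Fin 5) : skewCirculant α β i 0 - skewCirculant α β i 1 -
      z * ((if i = 0 then 1 else 0) - (if i = 1 then 1 else 0)) = c := by
    simpa [edgeFun_apply] using hc (e.symm i)
  have hcol0 : α - z = c := by simpa [skewCirculant] using hcol 0
  have hcol1 : α + z = c := by simpa [skewCirculant] using hcol 1
  have hcol2 : β - α = c := by simpa [skewCirculant] using hcol 2
  have hcol3 : -β - β = c := by simpa [skewCirculant] using hcol 3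
  have hβ0 : (2 : F) * 5 * β = 0 := by
    linear_combination hcol0 + hcol1 + 2 * hcol2 - 4 * hcol3
  exact mul_ne_zero (mul_ne_zero h2 h5) hβ hβ0

theorem not_isVerySimple_heartRepAlt [DecidableEq B] (hB : Fintype.card B = 5) {s : F}
    (hs : s * s = 5) (h2 : (2 : F) ≠ 0) (h5 : (5 : F) ≠ 0) :
    ¬ IsVerySimple (heartRepAlt F B) := by
  let e : B ≃ Fin 5 := Fintype.equivFinOfCardEq hB
  have hs2 : 2 + s ≠ 0 :=
    left_ne_zero_of_mul_eq_one (b := s - 2) (by linear_combination hs)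
  refine not_isVerySimple_of_forall_commute_conj
    (matrixEnd_skewCirculant_notMem_bot e (α := 1) h2 h5 hs2)
    (matrixEnd_skewCirculant_notMem_bot e (α := 2 + s) h2 h5 (neg_ne_zero.2 one_ne_zero))
    fun g => ?_
  have hconj : heartRepAlt F B g *
      matrixEnd ((isBalanced_skewCirculant (2 + s) (-1)).submatrix e) * heartRepAlt F B g⁻¹ = _ :=
    heartRep_mul_matrixEnd_mul _ (g : Equiv.Perm B)
  rw [hconj]
  refine commute_matrixEnd _ _ (Commute.symm ?_)
  have hsign : Equiv.Perm.sign (e.permCongr (g : Equiv.Perm B)⁻¹) = 1 := by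
    rw [Equiv.Perm.sign_permCongr, Equiv.Perm.sign_inv]
    exact g.2
  have h := (commute_skewCirculant_submatrix hs hsign).map (reindexAlgEquiv F F e.symm)
  simpa [Function.comp_def] using h

end FivePoints

section AlternatingGroup

variable {B : Type*} [Fintype B] [DecidableEq B]

theorem five_dvd_natCard_alternatingGroup (hB : 5 ≤ Fintype.card B) :
    5 ∣ Nat.card (alternatingGroup B) := by
  have : Nontrivial B := Fintype.one_lt_card_iff_nontrivial.1 (by lia)
  have hdvd : 5 ∣ 2 * Nat.card (alternatingGroup B) := by
    rw [two_mul_nat_card_alternatingGroup, Nat.card_perm, Nat.card_eq_fintype_card]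
    exact Nat.dvd_factorial (by norm_num) hB
  exact Nat.Coprime.dvd_of_dvd_mul_left (by norm_num) hdvd

theorem monoidHom_perm_eq_one (hB : 5 ≤ Fintype.card B) {X : Type*} [Finite X]
    (hX : Nat.card X < Fintype.card B) (f : alternatingGroup B →* Equiv.Perm X) : f = 1 := by
  have : IsSimpleGroup (alternatingGroup B) :=
    alternatingGroup.isSimpleGroup (by rwa [Nat.card_eq_fintype_card])
  have : Nontrivial B := Fintype.one_lt_card_iff_nontrivial.1 (by lia)
  rw [← MonoidHom.ker_eq_top_iff]
  refine (IsSimpleGroup.eq_bot_or_eq_top_of_normal f.ker inferInstance).resolve_left fun hker => ?_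
  obtain ⟨n, hn⟩ : ∃ n, Fintype.card B = n + 1 := ⟨Fintype.card B - 1, by lia⟩
  have hle : Nat.card (alternatingGroup B) ≤ n.factorial := by
    refine (Nat.card_le_card_of_injective f ((MonoidHom.ker_eq_bot_iff f).1 hker)).trans ?_
    rw [Nat.card_perm]
    exact Nat.factorial_le (by lia)
  have hcard : 2 * Nat.card (alternatingGroup B) = (n + 1) * n.factorial := by
    rw [two_mul_nat_card_alternatingGroup, Nat.card_perm, Nat.card_eq_fintype_card, hn,
      Nat.factorial_succ]
  have hpos := n.factorial_pos
  nlinarith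

end AlternatingGroup

section FiniteFields

variable {F : Type*} [Field F] [Finite F]

theorem prime_dvd_natCard_iff {p : ℕ} [Fact p.Prime] : p ∣ Nat.card F ↔ (p : F) = 0 := by
  have := Fintype.ofFinite F
  rw [Nat.card_eq_fintype_card, ← prime_dvd_char_iff_dvd_card, ← not_iff_not,
    ← isUnit_iff_not_dvd_char, isUnit_iff_ne_zero]

theorem natCard_sq_eq_one_of_five_dvd (h5 : (5 : F) ≠ 0)
    (hdvd : 5 ∣ Nat.card F * (Nat.card F ^ 2 - 1)) : (Nat.card F : ZMod 5) ^ 2 = 1 := by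
  have : Fact (Nat.Prime 5) := ⟨Nat.prime_five⟩
  have hcard : ¬ 5 ∣ Nat.card F := fun h => h5 (by exact_mod_cast prime_dvd_natCard_iff.1 h)
  have hdvd' := (Nat.prime_five.dvd_mul.1 hdvd).resolve_left hcard
  rw [← ZMod.natCast_eq_zero_iff, Nat.cast_sub (Nat.one_le_pow _ _ Nat.card_pos)] at hdvd'
  simpa [sub_eq_zero] using hdvd'

theorem five_ne_zero_of_natCard_sq_eq_one (hq : (Nat.card F : ZMod 5) ^ 2 = 1) :
    (5 : F) ≠ 0 := by
  intro h5
  have : Fact (Nat.Prime 5) := ⟨Nat.prime_five⟩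
  have hdvd : 5 ∣ Nat.card F := prime_dvd_natCard_iff.2 (by exact_mod_cast h5)
  rw [(ZMod.natCast_eq_zero_iff _ _).2 hdvd] at hq
  exact absurd hq (by decide)

theorem six_ne_zero_of_natCard_sq_eq_one (hsq : ¬ IsSquare (Nat.card F))
    (hq : (Nat.card F : ZMod 5) ^ 2 = 1) : (6 : F) ≠ 0 := by
  intro h6
  have := Fintype.ofFinite F
  obtain ⟨k, hp, hk⟩ := FiniteField.card F (ringChar F)
  have hdvd : ringChar F ∣ 6 := (ringChar.spec F 6).1 (by simpa using h6)
  -- The characteristic is `2` or `3`, a square root of `-1` modulo `5`, and `|F|` is an odd power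
  -- of it.
  have hchar : ((ringChar F : ℕ) : ZMod 5) ^ 2 = -1 := by
    have hle : ringChar F ≤ 6 := Nat.le_of_dvd (by norm_num) hdvd
    interval_cases ringChar F <;> revert hp hdvd <;> decide
  rw [Nat.card_eq_fintype_card, hk] at hsq hq
  have hodd : Odd (k : ℕ) := Nat.not_even_iff_odd.1 fun hk => hsq (hk.isSquare_pow _)
  rw [Nat.cast_pow, ← pow_mul, mul_comm, pow_mul, hchar, hodd.neg_one_pow] at hq
  revert hq
  decide

theorem isSquare_five (h2 : (2 : F) ≠ 0) (hq : (Nat.card F : ZMod 5) ^ 2 = 1) :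
    IsSquare (5 : F) := by
  have hneg_one : IsSquare (-1 : ZMod 5) := ⟨2, by decide⟩
  have := Fintype.ofFinite F
  have : Fact (Nat.Prime 5) := ⟨Nat.prime_five⟩
  have hF : ringChar F ≠ 2 := fun h => h2 (by simpa [h] using ringChar.Nat.cast_ringChar (R := F))
  have hodd := FiniteField.odd_card_of_char_ne_two hF
  have hχ : ZMod.χ₄ (Fintype.card F) = 1 ∨ ZMod.χ₄ (Fintype.card F) = -1 := by
    rw [ZMod.χ₄_eq_neg_one_pow hodd]
    exact neg_one_pow_eq_or ℤ _
  rw [Nat.card_eq_fintype_card, sq_eq_one_iff] at hq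
  refine (FiniteField.isSquare_odd_prime_iff hF (p := 5) (by norm_num)).2 ?_
  rw [Ne, quadraticChar_neg_one_iff_not_isSquare, not_not]
  rcases hχ with hχ | hχ <;> rcases hq with hq | hq <;> simp [hχ, hq, hneg_one]

end FiniteFields

section NormalSubalgebras

variable {F B : Type*} [Field F] [Finite F] [Fintype B] [DecidableEq B]

theorem isCentralSimpleModule_heartRepAlt (hB : 5 ≤ Fintype.card B) :
    IsCentralSimpleModule (heartRepAlt F B) := by
  intro R hR
  have : Nonempty B := Fintype.card_pos_iff.1 (by lia)
  have := isIrreducible_heartRepAlt (F := F) hB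
  have : Group.IsPerfect (alternatingGroup B) :=
    ⟨commutator_alternatingGroup_eq_top (by rwa [Nat.card_eq_fintype_card])⟩
  have := isSemisimpleModule_of_isNormalSubalgebra hR
  have : Finite (isotypicComponents R (Heart F B)) :=
    have := isNoetherian_of_tower (R := F) (S := R) (M := Heart F B) inferInstance
    inferInstance
  have hcard : Nat.card (isotypicComponents R (Heart F B)) < Fintype.card B :=
    (card_isotypicComponents_le_finrank (F := F)).trans_lt (finrank_heart_lt_card F)
  have : IsSimpleRing R :=
    isSimpleRing_of_isotypicPerm_eq_one hR (monoidHom_perm_eq_one hB hcard _)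
  exact ⟨isCentral_of_isNormalSubalgebra (centralizer_range_heartRepAlt hB) hR, this⟩

variable {R : Subalgebra F (Module.End F (Heart F B))}

theorem finrank_heart_eq_four_and_hasSimplePlane (hB : 5 ≤ Fintype.card B)
    (hR : IsNormalSubalgebra (heartRepAlt F B) R) (hbot : R ≠ ⊥) (htop : R ≠ ⊤) :
    Module.finrank F (Heart F B) = 4 ∧ HasSimplePlane R := by
  obtain ⟨hcentral, hsimple⟩ := isCentralSimpleModule_heartRepAlt hB R hR
  have := isIrreducible_heartRepAlt (F := F) hB
  have : IsSimpleGroup (alternatingGroup B) :=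
    alternatingGroup.isSimpleGroup (by rwa [Nat.card_eq_fintype_card])
  refine finrank_eq_four_and_hasSimplePlane (centralizer_range_heartRepAlt hB) hR
    alternatingGroup.closure_isThreeCycles_eq_top (fun s hs => ?_) hbot htop
  have hs' : (s : Equiv.Perm B).IsThreeCycle := hs
  exact (finrank_range_heartRep_sub_one_le hs'.ne_one).trans (by rw [hs'.card_support])

theorem eq_bot_or_eq_top_or_nonempty_algEquiv_matrix (hB : 5 ≤ Fintype.card B)
    (hR : IsNormalSubalgebra (heartRepAlt F B) R) :
    R = ⊥ ∨ R = ⊤ ∨ Nonempty (R ≃ₐ[F] Matrix (Fin 2) (Fin 2) F) := by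
  by_contra! hne
  obtain ⟨hcentral, hsimple⟩ := isCentralSimpleModule_heartRepAlt hB R hR
  have hplane := (finrank_heart_eq_four_and_hasSimplePlane hB hR hne.1 hne.2.1).2
  exact not_nonempty_iff.2 hne.2.2 hplane.nonempty_algEquiv_matrix

omit [DecidableEq B] in
theorem isVerySimple_heartRep (hB : 5 ≤ Fintype.card B) : IsVerySimple (heartRep F B) := by
  classical
  intro R hR
  by_contra! hne
  obtain ⟨hbot, htop⟩ := not_or.1 hne
  obtain ⟨hV, hplane⟩ :=
    finrank_heart_eq_four_and_hasSimplePlane hB (fun g => hR g) hbot htop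
  have := isIrreducible_heartRep (F := F) hB
  refine not_hasSimplePlane hR Equiv.Perm.closure_isSwap (fun s hs => ?_) (by lia) hplane
  have hs2 := Equiv.Perm.card_support_eq_two.2 hs
  have hs1 : s ≠ 1 := fun h => by simp [h] at hs2
  exact (finrank_range_heartRep_sub_one_le hs1).trans (by rw [hs2])

theorem card_eq_five_of_isNormalSubalgebra (hF : ¬ IsSquare (Nat.card F))
    (hB : 5 ≤ Fintype.card B) (hR : IsNormalSubalgebra (heartRepAlt F B) R) (hbot : R ≠ ⊥)
    (htop : R ≠ ⊤) : Fintype.card B = 5 ∧ (Nat.card F : ZMod 5) ^ 2 = 1 := by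
  have : Nonempty B := Fintype.card_pos_iff.1 (by lia)
  obtain ⟨hV, hplane⟩ := finrank_heart_eq_four_and_hasSimplePlane hB hR hbot htop
  obtain ⟨hcentral, hsimple⟩ := isCentralSimpleModule_heartRepAlt hB R hR
  have : IsSimpleGroup (alternatingGroup B) :=
    alternatingGroup.isSimpleGroup (by rwa [Nat.card_eq_fintype_card])
  have hdvd : 5 ∣ Nat.card F * (Nat.card F ^ 2 - 1) :=
    (five_dvd_natCard_alternatingGroup hB).trans
      (hplane.natCard_dvd (centralizer_range_heartRepAlt hB) hR hbot)
  by_cases hBF : (Fintype.card B : F) = 0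
  · have h6 : (6 : F) = 0 := by
      have hcard := finrank_heart_add_two hBF
      rw [hV] at hcard
      simpa [← hcard] using hBF
    have h5 : (5 : F) ≠ 0 := fun h5 => one_ne_zero (α := F) (by linear_combination h6 - h5)
    exact absurd h6 (six_ne_zero_of_natCard_sq_eq_one hF (natCard_sq_eq_one_of_five_dvd h5 hdvd))
  · have hcard : Fintype.card B = 5 := by
      rw [← finrank_heart_add_one hBF, hV]
    exact ⟨hcard, natCard_sq_eq_one_of_five_dvd (by simpa [hcard] using hBF) hdvd⟩

theorem isVerySimple_heartRepAlt_iff (hF : ¬ IsSquare (Nat.card F)) (hB : 5 ≤ Fintype.card B) :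
    IsVerySimple (heartRepAlt F B) ↔
      ¬ (Fintype.card B = 5 ∧ (Nat.card F : ZMod 5) ^ 2 = 1) := by
  constructor
  · rintro hvs ⟨hcard, hq⟩
    have h6 := six_ne_zero_of_natCard_sq_eq_one hF hq
    have h2 : (2 : F) ≠ 0 := fun h2 => h6 (by linear_combination 3 * h2)
    obtain ⟨s, hs⟩ := isSquare_five h2 hq
    exact not_isVerySimple_heartRepAlt hcard hs.symm h2 (five_ne_zero_of_natCard_sq_eq_one hq) hvs
  · intro hne R hR
    by_contra! hR'
    obtain ⟨hbot, htop⟩ := not_or.1 hR'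
    exact hne (card_eq_five_of_isNormalSubalgebra hF hB hR hbot htop)

end NormalSubalgebras

end HeartModule

theorem mainTheorem8_general {F B : Type*} [Field F] [Finite F] [Fintype B] [DecidableEq B]
    (hB : 5 ≤ Fintype.card B) :
    HeartModule.IsVerySimple (HeartModule.heartRep F B) ∧
    (¬ IsSquare (Nat.card F) → (HeartModule.IsVerySimple (HeartModule.heartRepAlt F B) ↔
      5 < Fintype.card B ∨ (Fintype.card B = 5 ∧
        ¬ ((Nat.card F : ℤ) ≡ 1 [ZMOD 5] ∨ (Nat.card F : ℤ) ≡ -1 [ZMOD 5])))) ∧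
    (∀ R : Subalgebra F (Module.End F (HeartModule.Heart F B)),
      HeartModule.IsNormalSubalgebra (HeartModule.heartRepAlt F B) R →
        R = ⊥ ∨ R = ⊤ ∨ Nonempty (R ≃ₐ[F] Matrix (Fin 2) (Fin 2) F)) ∧
    HeartModule.IsCentralSimpleModule (HeartModule.heartRepAlt F B) := by
  refine ⟨HeartModule.isVerySimple_heartRep hB, fun hF => ?_,
    fun R => HeartModule.eq_bot_or_eq_top_or_nonempty_algEquiv_matrix hB,
    HeartModule.isCentralSimpleModule_heartRepAlt hB⟩
  have : Fact (Nat.Prime 5) := ⟨Nat.prime_five⟩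
  have hmod (a : ℤ) : (Nat.card F : ℤ) ≡ a [ZMOD 5] ↔ (Nat.card F : ZMod 5) = a := by
    simpa using (ZMod.intCast_eq_intCast_iff (Nat.card F) a 5).symm
  rw [HeartModule.isVerySimple_heartRepAlt_iff hF hB, sq_eq_one_iff, hmod, hmod, Int.cast_one,
    Int.cast_neg, Int.cast_one]
  grind

theorem mainTheorem8 (n : ℕ) (hn : 5 ≤ n) (B : Type*) [Fintype B] [DecidableEq B]
    (hB : Fintype.card B = n) (p : ℕ) [Fact p.Prime] :
    -- the heart is a very simple `Perm(B)`-module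
    HeartModule.IsVerySimple (HeartModule.heartRep (ZMod p) B) ∧
    -- it is a very simple `Alt(B)`-module iff `n > 5`, or `n = 5` and `p ≢ ±1 mod 5`
    (HeartModule.IsVerySimple (HeartModule.heartRepAlt (ZMod p) B) ↔
      5 < n ∨ (n = 5 ∧ ¬ ((p : ℤ) ≡ 1 [ZMOD 5] ∨ (p : ℤ) ≡ -1 [ZMOD 5]))) ∧
    -- if `n = 5` and `p ≡ ±1 mod 5`, the `Alt(B)`-normal subalgebras
    (n = 5 → ((p : ℤ) ≡ 1 [ZMOD 5] ∨ (p : ℤ) ≡ -1 [ZMOD 5]) →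
      ∀ R : Subalgebra (ZMod p) (Module.End (ZMod p) (HeartModule.Heart (ZMod p) B)),
        HeartModule.IsNormalSubalgebra (HeartModule.heartRepAlt (ZMod p) B) R →
          R = ⊥ ∨ R = ⊤ ∨ Nonempty (R ≃ₐ[ZMod p] Matrix (Fin 2) (Fin 2) (ZMod p))) ∧
    -- the heart is a central simple `Alt(B)`-module
    HeartModule.IsCentralSimpleModule (HeartModule.heartRepAlt (ZMod p) B) := by
  subst hB
  obtain ⟨hperm, halt, hnormal, hcentral⟩ := mainTheorem8_general (F := ZMod p) hn
  rw [Nat.card_zmod] at halt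
  exact ⟨hperm, halt (Fact.out : p.Prime).prime.not_isSquare, fun _ _ => hnormal, hcentral⟩
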